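/- Let $(\Omega,\mathcal F,P)$ be a probability space and let $T:\Omega\to\Omega$ be an invertible measurable transformation (a bijection such that $T$ and $T^{-1}$ are $\mathcal F$-measurable); $P$ is not assumed to be $T$-invariant. Suppose that for every $A\in\mathcal F$ the limit $$Q(A):=\lim_{n\to\infty}\frac1n\sum_{i=0}^{n-1}P(T^iA)$$ exists. Then $Q$ is a $T$-invariant probability on $(\Omega,\mathcal F)$. Moreover, the following three statements are equivalent: (i) $Q$ is ergodic, i.e. $Q(A)\in\{0,1\}$ for every $A\in\mathcal F$ with $T^{-1}A=A$; (ii) for all $B,C\in\mathcal F$, $$\lim_{\substack{m+n\to\infty\\ m,n\ge 0}}\frac{1}{m+n+1}\sum_{i=-m}^{n}P(B\cap T^iC)=P(B)\,Q(C);$$ (iii) for every $\mathcal F$-measurable $f:\Omega\to\mathbb R$ with $\int|f|\,dQ<\infty$, $$\lim_{\substack{m+n\to\infty\\ m,n\ge 0}}\frac{1}{m+n+1}\sum_{i=-m}^{n}f(T^i\omega)=\int f\,dQ\quad\text{for }P\text{-a.e. }\omega\in\Omega.$$ Here $\lim_{m+n\to\infty,\;m,n\ge0}$ means: for every $\varepsilon>0$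 there is $N$ such that the quantity is within $\varepsilon$ of the limit for all integers $m,n\ge0$ with $m+n\ge N$. -/

import Mathlib

open MeasureTheory Filter Topology

/-- The `i`-th iterate `T ^ i`, `i : ℤ`, of an invertible bimeasurable transformation. -/
def iterZ {Ω : Type*} [MeasurableSpace Ω] (T : Ω ≃ᵐ Ω) (i : ℤ) : Ω → Ω :=
  ((T.toEquiv : Equiv.Perm Ω) ^ i : Equiv.Perm Ω)

/-- The one-sided Cesàro average `(1 / n) * ∑_{i = 0}^{n - 1} P (T ^ i A)`. -/
noncomputable def cesaroImage {Ω : Type*} [MeasurableSpace Ω] (P : Measure Ω) (T : Ω ≃ᵐ Ω)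
    (A : Set Ω) (n : ℕ) : ℝ :=
  (1 / (n : ℝ)) * ∑ i ∈ Finset.range n, P.real (iterZ T (i : ℤ) '' A)

/-- The two-sided average `(1 / (m + n + 1)) * ∑_{i = -m}^{n} a i`. -/
noncomputable def twoSidedAverage (a : ℤ → ℝ) (m n : ℕ) : ℝ :=
  (1 / ((m : ℝ) + (n : ℝ) + 1)) * ∑ i ∈ Finset.Icc (-(m : ℤ)) (n : ℤ), a i

/-- The two-sided averages of `a` over `{-m, …, n}` converge to `l` as `m + n → ∞`, `m, n ≥ 0`. -/
def TendstoTwoSided (a : ℤ → ℝ) (l : ℝ) : Prop :=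
  Tendsto (fun p : ℕ × ℕ => twoSidedAverage a p.1 p.2)
    (comap (fun p : ℕ × ℕ => p.1 + p.2) atTop) (𝓝 l)

/-! The averaged images of `P` are finite measures converging setwise, so by Nikodym's theorem
(`exists_measure_of_tendsto_measureReal`, via Baire category) the limit `Q` is countably additive.
It is invariant because replacing `A` by its preimage changes the averages by at most `1 / n`.

Two facts link `P` to `Q`: they agree on invariant sets, since the averages are constant there, and
hence `P ≪ Q` (`absolutelyContinuous_of_tendsto_cesaroImage`).

If `Q` is ergodic, Birkhoff's theorem for `T` and for its inverse gives two-sided convergence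
`Q`-a.e., which absolute continuity carries over to `P`. Integrating the pointwise statement for an
indicator over `B` gives the averaged mixing relation by dominated convergence. Taking `B = C = A`
invariant in that relation gives `Q(A) = Q(A)²`, which is ergodicity. -/

/-! ### Setwise limits of finite measures -/

section Nikodym

variable {Ω : Type*} [MeasurableSpace Ω]

/-- The union of the sets `B j` over the indices `j` selected by `S`. -/
def selectedUnion (B : ℕ → Set Ω) (S : ℕ → Bool) : Set Ω :=
  ⋃ j, if S j then B j else ∅

theorem measurableSet_selectedUnion {B : ℕ → Set Ω} (hB : ∀ j, MeasurableSet (B j))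
    (S : ℕ → Bool) : MeasurableSet (selectedUnion B S) := by
  refine MeasurableSet.iUnion fun j => ?_
  split_ifs
  exacts [hB j, MeasurableSet.empty]

theorem measureReal_selectedUnion (μ : Measure Ω) [IsFiniteMeasure μ] {B : ℕ → Set Ω}
    (hB : ∀ j, MeasurableSet (B j)) (hd : Pairwise (Function.onFun Disjoint B)) (S : ℕ → Bool) :
    μ.real (selectedUnion B S) = ∑' j, if S j then μ.real (B j) else 0 := by
  rw [selectedUnion, measureReal_def, measure_iUnion, ENNReal.tsum_toReal_eq]
  · refine tsum_congr fun j => ?_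
    split_ifs <;> simp [measureReal_def]
  · exact fun j => measure_ne_top _ _
  · intro i j hij
    have := hd hij
    simp only [Function.onFun] at this ⊢
    split_ifs <;> simp [this]
  · intro j
    split_ifs
    exacts [hB j, MeasurableSet.empty]

theorem summable_measureReal_of_disjoint (μ : Measure Ω) [IsFiniteMeasure μ] {B : ℕ → Set Ω}
    (hB : ∀ j, MeasurableSet (B j)) (hd : Pairwise (Function.onFun Disjoint B)) :
    Summable fun j => μ.real (B j) := by
  refine ENNReal.summable_toReal ?_
  rw [← measure_iUnion hd hB]
  exact measure_ne_top _ _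

/-- Weierstrass M-test: each term depends on one coordinate of the selection and is dominated by the
summable sequence `μ.real (B j)`. This opens the compact space of selections to Baire's theorem. -/
theorem continuous_measureReal_selectedUnion (μ : Measure Ω) [IsFiniteMeasure μ] {B : ℕ → Set Ω}
    (hB : ∀ j, MeasurableSet (B j)) (hd : Pairwise (Function.onFun Disjoint B)) :
    Continuous fun S : ℕ → Bool => μ.real (selectedUnion B S) := by
  simp_rw [measureReal_selectedUnion μ hB hd]
  refine continuous_tsum (u := fun j => μ.real (B j)) (fun j => ?_)
    (summable_measureReal_of_disjoint μ hB hd) fun j S => ?_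
  · exact (continuous_of_discreteTopology (f := fun b : Bool => if b then μ.real (B j) else 0)).comp
      (continuous_apply j)
  · rw [Real.norm_eq_abs, abs_of_nonneg] <;> split_ifs <;> simp

theorem tendsto_measureReal_tail (μ : Measure Ω) [IsFiniteMeasure μ] {B : ℕ → Set Ω}
    (hB : ∀ j, MeasurableSet (B j)) (hd : Pairwise (Function.onFun Disjoint B)) :
    Tendsto (fun k => μ.real (selectedUnion B fun j => decide (k ≤ j))) atTop (𝓝 0) := by
  have hlim : Tendsto (fun k j => decide (k ≤ j) : ℕ → ℕ → Bool) atTop (𝓝 fun _ => false) := by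
    refine tendsto_pi_nhds.2 fun j => tendsto_const_nhds.congr' ?_
    filter_upwards [eventually_gt_atTop j] with k hk
    simp [hk]
  have h := ((continuous_measureReal_selectedUnion μ hB hd).tendsto fun _ => false).comp hlim
  have h0 : μ.real (selectedUnion B fun _ => false) = 0 := by simp [selectedUnion]
  rwa [h0] at h

/-- **Nikodym's convergence theorem**: a setwise limit of finite measures is continuous along the
tails of a sequence of disjoint sets. -/
theorem tendsto_tail_of_tendsto_measureReal (μ : ℕ → Measure Ω) [∀ n, IsFiniteMeasure (μ n)]
    {ν : Set Ω → ℝ}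
    (hν : ∀ A, MeasurableSet A → Tendsto (fun n => (μ n).real A) atTop (𝓝 (ν A)))
    {B : ℕ → Set Ω} (hB : ∀ j, MeasurableSet (B j)) (hd : Pairwise (Function.onFun Disjoint B)) :
    Tendsto (fun k => ν (selectedUnion B fun j => decide (k ≤ j))) atTop (𝓝 0) := by
  rw [Metric.tendsto_atTop]
  intro ε hε
  -- Selections on which all measures from `N` on stay `ε / 4`-close to the `N`-th. These sets are
  -- closed, and they cover because convergent sequences are Cauchy, so one has nonempty interior.
  let F : ℕ → Set (ℕ → Bool) := fun N => ⋂ n ≥ N,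
    {S | |(μ n).real (selectedUnion B S) - (μ N).real (selectedUnion B S)| ≤ ε / 4}
  have hF : ∀ N, IsClosed (F N) := fun N => isClosed_iInter fun n => isClosed_iInter fun _ =>
    isClosed_le ((continuous_measureReal_selectedUnion (μ n) hB hd).sub
      (continuous_measureReal_selectedUnion (μ N) hB hd)).abs continuous_const
  have hU : ⋃ N, F N = Set.univ := by
    refine Set.eq_univ_of_forall fun S => ?_
    obtain ⟨N, hN⟩ := Metric.cauchySeq_iff'.1
      (hν _ (measurableSet_selectedUnion hB S)).cauchySeq (ε / 4) (by positivity)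
    exact Set.mem_iUnion.2 ⟨N, Set.mem_iInter₂.2 fun n hn => (hN n hn).le⟩
  obtain ⟨N, S₀, hS₀⟩ := nonempty_interior_of_iUnion_of_closed hF hU
  obtain ⟨I, u, hu, hsub⟩ := isOpen_pi_iff.1 isOpen_interior S₀ hS₀
  obtain ⟨K, hK⟩ := I.exists_nat_subset_range
  obtain ⟨K', hK'⟩ := Metric.tendsto_atTop.1 (tendsto_measureReal_tail (μ N) hB hd) (ε / 4)
    (by positivity)
  refine ⟨max K K', fun k hk => ?_⟩
  -- The interior contains a cylinder constraining only coordinates below `k`, so both constant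
  -- continuations of `S₀` past `k` lie in `F N`. Their difference is exactly the tail, whose
  -- oscillation is therefore at most `ε / 4 + ε / 4`.
  have hmem : ∀ b : Bool, (fun j => if j < k then S₀ j else b) ∈ F N := fun b => by
    refine interior_subset (hsub fun a ha => ?_)
    have : a < k := (Finset.mem_range.1 (hK ha)).trans_le ((le_max_left _ _).trans hk)
    simpa [this] using (hu a ha).2
  have hsplit : ∀ n, (μ n).real (selectedUnion B fun j => decide (k ≤ j)) =
      (μ n).real (selectedUnion B fun j => if j < k then S₀ j else true) -
      (μ n).real (selectedUnion B fun j => if j < k then S₀ j else false) := fun n => by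
    have hs : ∀ S : ℕ → Bool, Summable fun j => if S j then (μ n).real (B j) else 0 := fun S =>
      (summable_measureReal_of_disjoint (μ n) hB hd).of_nonneg_of_le
        (fun j => by split_ifs <;> simp) (fun j => by split_ifs <;> simp)
    simp_rw [measureReal_selectedUnion (μ n) hB hd]
    rw [← (hs _).tsum_sub (hs _)]
    refine tsum_congr fun j => ?_
    by_cases hj : j < k
    · simp [hj]
    · simp [hj, not_lt.1 hj]
  have hbound : ∀ n ≥ N, |(μ n).real (selectedUnion B fun j => decide (k ≤ j)) -
      (μ N).real (selectedUnion B fun j => decide (k ≤ j))| ≤ ε / 2 := fun n hn => by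
    have h1 := Set.mem_iInter₂.1 (hmem true) n hn
    have h2 := Set.mem_iInter₂.1 (hmem false) n hn
    simp only [Set.mem_ofPred_eq] at h1 h2
    rw [hsplit, hsplit]
    rw [abs_le] at h1 h2 ⊢
    constructor <;> linarith
  have hlim := le_of_tendsto
    ((hν _ (measurableSet_selectedUnion hB fun j => decide (k ≤ j))).sub_const
      ((μ N).real (selectedUnion B fun j => decide (k ≤ j)))).abs
    ((eventually_ge_atTop N).mono hbound)
  have hN := hK' k ((le_max_right _ _).trans hk)
  rw [Real.dist_eq, sub_zero, abs_lt] at hN ⊢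
  rw [abs_le] at hlim
  constructor <;> linarith

/-- A setwise limit of finite measures is a measure. -/
theorem exists_measure_of_tendsto_measureReal (μ : ℕ → Measure Ω) [∀ n, IsFiniteMeasure (μ n)]
    (h : ∀ A, MeasurableSet A → ∃ l, Tendsto (fun n => (μ n).real A) atTop (𝓝 l)) :
    ∃ Q : Measure Ω, IsFiniteMeasure Q ∧
      ∀ A, MeasurableSet A → Tendsto (fun n => (μ n).real A) atTop (𝓝 (Q.real A)) := by
  choose! ν hν using h
  have hnonneg : ∀ A, MeasurableSet A → 0 ≤ ν A := fun A hA =>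
    ge_of_tendsto' (hν A hA) fun n => measureReal_nonneg
  have hempty : ν ∅ = 0 :=
    tendsto_nhds_unique (hν ∅ MeasurableSet.empty) (by simp)
  have hadd : ∀ A B, MeasurableSet A → MeasurableSet B → Disjoint A B →
      ν (A ∪ B) = ν A + ν B := fun A B hA hB hAB =>
    tendsto_nhds_unique (hν _ (hA.union hB)) <|
      ((hν A hA).add (hν B hB)).congr fun n => (measureReal_union hAB hB).symm
  have hunion : ∀ B : ℕ → Set Ω, (∀ j, MeasurableSet (B j)) →
      Pairwise (Function.onFun Disjoint B) → HasSum (fun j => ν (B j)) (ν (⋃ j, B j)) := by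
    intro B hB hd
    rw [hasSum_iff_tendsto_nat_of_nonneg fun j => hnonneg _ (hB j)]
    have hmt : ∀ k, MeasurableSet (selectedUnion B fun j => decide (k ≤ j)) := fun k =>
      measurableSet_selectedUnion hB _
    have htail : ∀ k, ∑ j ∈ Finset.range k, ν (B j) =
        ν (⋃ j, B j) - ν (selectedUnion B fun j => decide (k ≤ j)) := by
      intro k
      induction k with
      | zero => simp [selectedUnion]
      | succ k ih =>
        have hsplit : selectedUnion B (fun j => decide (k ≤ j)) =
            B k ∪ selectedUnion B fun j => decide (k + 1 ≤ j) := by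
          ext x
          simp only [selectedUnion, decide_eq_true_eq, Set.mem_iUnion, Set.mem_ite_empty_right,
            Set.mem_union]
          constructor
          · rintro ⟨j, hj, hx⟩
            rcases hj.eq_or_lt with rfl | hj
            exacts [Or.inl hx, Or.inr ⟨j, hj, hx⟩]
          · rintro (hx | ⟨j, hj, hx⟩)
            exacts [⟨k, le_rfl, hx⟩, ⟨j, by omega, hx⟩]
        have hdisj : Disjoint (B k) (selectedUnion B fun j => decide (k + 1 ≤ j)) := by
          refine Set.disjoint_iUnion_right.2 fun j => ?_
          split_ifs with hj
          · exact hd (by simp at hj; omega)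
          · simp
        rw [Finset.sum_range_succ, ih, hsplit, hadd _ _ (hB k) (hmt _) hdisj]
        ring
    simp_rw [htail]
    simpa using (tendsto_tail_of_tendsto_measureReal μ hν hB hd).const_sub (ν (⋃ j, B j))
  let Q : Measure Ω := Measure.ofMeasurable (fun A _ => ENNReal.ofReal (ν A)) (by simp [hempty])
    (fun B hB hd => by
      rw [← (hunion B hB hd).tsum_eq,
        ENNReal.ofReal_tsum_of_nonneg (fun j => hnonneg _ (hB j)) (hunion B hB hd).summable])
  have hQ : ∀ A, MeasurableSet A → Q A = ENNReal.ofReal (ν A) := fun A hA =>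
    Measure.ofMeasurable_apply A hA
  refine ⟨Q, ⟨by simp [hQ]⟩, fun A hA => ?_⟩
  rw [measureReal_def, hQ A hA, ENNReal.toReal_ofReal (hnonneg A hA)]
  exact hν A hA

end Nikodym

/-! ### The pointwise ergodic theorem for ergodic transformations -/

section Birkhoff

variable {Ω : Type*}

/-- The running maximum of `0` and the first `n` Birkhoff sums. -/
def birkhoffMax (T : Ω → Ω) (g : Ω → ℝ) : ℕ → Ω → ℝ
  | 0 => fun _ => 0
  | n + 1 => fun x => max 0 (g x + birkhoffMax T g n (T x))

theorem birkhoffMax_nonneg (T : Ω → Ω) (g : Ω → ℝ) (n : ℕ) (x : Ω) : 0 ≤ birkhoffMax T g n x := by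
  cases n <;> simp [birkhoffMax]

theorem birkhoffMax_le_succ (T : Ω → Ω) (g : Ω → ℝ) (n : ℕ) (x : Ω) :
    birkhoffMax T g n x ≤ birkhoffMax T g (n + 1) x := by
  induction n generalizing x with
  | zero => exact birkhoffMax_nonneg T g 1 x
  | succ n ih => exact max_le_max le_rfl (add_le_add le_rfl (ih (T x)))

theorem monotone_birkhoffMax (T : Ω → Ω) (g : Ω → ℝ) (x : Ω) :
    Monotone fun n => birkhoffMax T g n x :=
  monotone_nat_of_le_succ fun n => birkhoffMax_le_succ T g n x

theorem birkhoffSum_le_birkhoffMax (T : Ω → Ω) (g : Ω → ℝ) (n : ℕ) (x : Ω) :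
    birkhoffSum T g n x ≤ birkhoffMax T g n x := by
  induction n generalizing x with
  | zero => simp [birkhoffMax]
  | succ n ih =>
    rw [birkhoffSum_succ']
    exact le_max_of_le_right (add_le_add le_rfl (ih (T x)))

variable [MeasurableSpace Ω] {μ : Measure Ω} {T : Ω → Ω}

theorem measurable_birkhoffMax {g : Ω → ℝ} (hT : Measurable T) (hg : Measurable g) (n : ℕ) :
    Measurable (birkhoffMax T g n) := by
  induction n with
  | zero => exact measurable_const
  | succ n ih => exact measurable_const.max (hg.add (ih.comp hT))

theorem integrable_birkhoffMax [IsFiniteMeasure μ] {g : Ω → ℝ} (hT : MeasurePreserving T μ μ)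
    (hg : Integrable g μ) (n : ℕ) : Integrable (birkhoffMax T g n) μ := by
  induction n with
  | zero => exact integrable_const 0
  | succ n ih => exact (integrable_const 0).sup (hg.add (hT.integrable_comp_of_integrable ih))

/-- If the running maxima of the Birkhoff sums of `g` are almost everywhere unbounded, then `g` has
nonnegative integral. -/
theorem integral_nonneg_of_ae_tendsto_birkhoffMax [IsFiniteMeasure μ] {g : Ω → ℝ}
    (hT : MeasurePreserving T μ μ) (hg : Integrable g μ)
    (h : ∀ᵐ x ∂μ, Tendsto (fun n => birkhoffMax T g n x) atTop atTop) : 0 ≤ ∫ x, g x ∂μ := by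
  have hcomp : ∀ n, Integrable (fun x => birkhoffMax T g n (T x)) μ := fun n =>
    hT.integrable_comp_of_integrable (integrable_birkhoffMax hT hg n)
  -- This truncation of `g` is bounded by `|g|` and equals `g` once the running maximum at `T x`
  -- reaches `-g x`. Its integral is nonnegative by invariance of `μ` and monotonicity in `n`.
  have heq : ∀ n x, birkhoffMax T g (n + 1) x - birkhoffMax T g n (T x) =
      max (-birkhoffMax T g n (T x)) (g x) := fun n x => by
    simp only [birkhoffMax]
    rw [max_sub_sub_right (0 : ℝ) _ _ |>.symm]
    congr 1 <;> ring
  have hpos : ∀ n, 0 ≤ ∫ x, (birkhoffMax T g (n + 1) x - birkhoffMax T g n (T x)) ∂μ := fun n => by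
    rw [integral_sub (integrable_birkhoffMax hT hg _) (hcomp n), sub_nonneg]
    have hmap : ∫ x, birkhoffMax T g n (T x) ∂μ = ∫ x, birkhoffMax T g n x ∂μ := by
      have hm : AEStronglyMeasurable (birkhoffMax T g n) (μ.map T) := by
        rw [hT.map_eq]; exact (integrable_birkhoffMax hT hg n).aestronglyMeasurable
      rw [← integral_map hT.measurable.aemeasurable hm, hT.map_eq]
    rw [hmap]
    exact integral_mono (integrable_birkhoffMax hT hg n) (integrable_birkhoffMax hT hg (n + 1))
      (birkhoffMax_le_succ T g n)
  refine ge_of_tendsto' (tendsto_integral_of_dominated_convergence (fun x => |g x|)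
    (fun n => ((integrable_birkhoffMax hT hg (n + 1)).sub (hcomp n)).aestronglyMeasurable)
    hg.abs (fun n => ?_) ?_) hpos
  · refine Eventually.of_forall fun x => ?_
    have := birkhoffMax_nonneg T g n (T x)
    simp only [Pi.sub_apply]
    rw [heq, Real.norm_eq_abs, abs_le]
    exact ⟨(neg_abs_le _).trans (le_max_right _ _),
      max_le (by linarith [abs_nonneg (g x)]) (le_abs_self _)⟩
  · filter_upwards [hT.quasiMeasurePreserving.ae h] with x hx
    refine tendsto_const_nhds.congr' ?_
    filter_upwards [hx.eventually_ge_atTop (-g x)] with n hn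
    simp only [Pi.sub_apply]
    rw [heq, max_eq_right (by linarith)]

/-- For an ergodic transformation, a function with negative integral has Birkhoff sums that are
almost everywhere bounded above. -/
theorem Ergodic.ae_bddAbove_birkhoffSum [IsFiniteMeasure μ] {g : Ω → ℝ} (hT : Ergodic T μ)
    (hgm : Measurable g) (hg : Integrable g μ) (hneg : ∫ x, g x ∂μ < 0) :
    ∀ᵐ x ∂μ, ∃ C, ∀ n, birkhoffSum T g n x ≤ C := by
  let E : Set Ω := {x | Tendsto (fun n => birkhoffMax T g n x) atTop atTop}
  have hEm : MeasurableSet E :=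
    measurableSet_tendsto _ fun n => measurable_birkhoffMax hT.measurable hgm n
  -- The maximum at `x` with index `n + 1` and the one at `T x` with index `n` differ by at most `|g
  -- x|`, so they diverge together.
  have hEinv : T ⁻¹' E = E := by
    ext x
    simp only [E, Set.mem_preimage, Set.mem_ofPred_eq]
    conv_rhs => rw [← tendsto_add_atTop_iff_nat 1]
    constructor
    · exact fun h => tendsto_atTop_mono (fun n => le_max_right _ _)
        (tendsto_atTop_add_const_left _ (g x) h)
    · intro h
      have h2 : Tendsto (fun n => -|g x| + birkhoffMax T g (n + 1) x) atTop atTop :=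
        tendsto_atTop_add_const_left _ _ h
      refine tendsto_atTop_mono (fun n => ?_) h2
      have h0 := birkhoffMax_nonneg T g n (T x)
      have : birkhoffMax T g (n + 1) x ≤ |g x| + birkhoffMax T g n (T x) :=
        max_le (by positivity) (add_le_add (le_abs_self _) le_rfl)
      linarith
  rcases hT.ae_mem_or_ae_notMem hEm hEinv with h | h
  · exact absurd (integral_nonneg_of_ae_tendsto_birkhoffMax hT.toMeasurePreserving hg h)
      (not_le.2 hneg)
  · filter_upwards [h] with x hx
    rcases tendsto_atTop_of_monotone (monotone_birkhoffMax T g x) with h' | ⟨l, hl⟩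
    · exact absurd h' hx
    · exact ⟨l, fun n => (birkhoffSum_le_birkhoffMax T g n x).trans
        ((monotone_birkhoffMax T g x).ge_of_tendsto hl n)⟩

theorem Ergodic.ae_eventually_birkhoffSum_le [IsProbabilityMeasure μ] {f : Ω → ℝ}
    (hT : Ergodic T μ) (hfm : Measurable f) (hf : Integrable f μ) {a : ℝ}
    (ha : ∫ x, f x ∂μ < a) :
    ∀ᵐ x ∂μ, ∃ C, ∀ n : ℕ, birkhoffSum T f n x ≤ C + n * a := by
  filter_upwards [hT.ae_bddAbove_birkhoffSum (g := fun x => f x - a) (hfm.sub_const a)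
    (hf.sub (integrable_const a)) (by
      rw [integral_sub hf (integrable_const a)]; simpa using ha)] with x ⟨C, hC⟩
  refine ⟨C, fun n => ?_⟩
  have := hC n
  simp only [birkhoffSum, Finset.sum_sub_distrib, Finset.sum_const, Finset.card_range,
    nsmul_eq_mul] at this ⊢
  linarith

/-- **Pointwise ergodic theorem** for an ergodic transformation of a probability space, in the form
of linear bounds for the centred Birkhoff sums. -/
theorem Ergodic.ae_abs_birkhoffSum_sub_le [IsProbabilityMeasure μ] {f : Ω → ℝ}
    (hT : Ergodic T μ) (hfm : Measurable f) (hf : Integrable f μ) :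
    ∀ᵐ x ∂μ, ∀ k : ℕ, ∃ C, ∀ n : ℕ,
      |birkhoffSum T f n x - n * ∫ y, f y ∂μ| ≤ C + n * (1 / ((k : ℝ) + 1)) := by
  rw [ae_all_iff]
  intro k
  have hk : (0 : ℝ) < 1 / ((k : ℝ) + 1) := by positivity
  filter_upwards [hT.ae_eventually_birkhoffSum_le hfm hf
      (a := ∫ y, f y ∂μ + 1 / ((k : ℝ) + 1)) (by linarith),
    hT.ae_eventually_birkhoffSum_le hfm.neg hf.neg
      (a := -∫ y, f y ∂μ + 1 / ((k : ℝ) + 1)) (by simp only [Pi.neg_apply, integral_neg]; linarith)]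
    with x ⟨C, hC⟩ ⟨D, hD⟩
  refine ⟨max C D, fun n => ?_⟩
  have h1 := hC n
  have h2 := hD n
  rw [birkhoffSum_neg] at h2
  have h3 := le_max_left C D
  have h4 := le_max_right C D
  rw [abs_le]
  constructor <;> nlinarith

end Birkhoff

/-! ### Integer iterates and Cesàro averages -/

section Iterates

variable {Ω : Type*} [MeasurableSpace Ω] (T : Ω ≃ᵐ Ω)

theorem iterZ_add (i j : ℤ) (x : Ω) : iterZ T (i + j) x = iterZ T i (iterZ T j x) := by
  simp [iterZ, zpow_add]

theorem iterZ_neg_apply_iterZ (i : ℤ) (x : Ω) : iterZ T (-i) (iterZ T i x) = x := by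
  rw [← iterZ_add]; simp [iterZ]

theorem iterZ_natCast (n : ℕ) : iterZ T (n : ℤ) = T^[n] := by
  simp only [iterZ, zpow_natCast]
  rfl

theorem iterZ_neg_natCast (n : ℕ) : iterZ T (-(n : ℤ)) = T.symm^[n] := by
  have : iterZ T (-(n : ℤ)) = ((T.toEquiv⁻¹ : Equiv.Perm Ω) ^ n : Equiv.Perm Ω) := by
    simp [iterZ, zpow_neg]
  rw [this, ← Equiv.Perm.iterate_eq_pow]
  rfl

theorem measurable_iterZ (i : ℤ) : Measurable (iterZ T i) := by
  obtain ⟨n, rfl | rfl⟩ := i.eq_nat_or_neg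
  · rw [iterZ_natCast]; exact T.measurable.iterate n
  · rw [iterZ_neg_natCast]; exact T.symm.measurable.iterate n

theorem measurePreserving_iterZ {T : Ω ≃ᵐ Ω} {Q : Measure Ω} (hT : MeasurePreserving T Q Q)
    (i : ℤ) : MeasurePreserving (iterZ T i) Q Q := by
  obtain ⟨n, rfl | rfl⟩ := i.eq_nat_or_neg
  · rw [iterZ_natCast]; exact hT.iterate n
  · rw [iterZ_neg_natCast]; exact (hT.symm T).iterate n

theorem image_iterZ (i : ℤ) (A : Set Ω) : iterZ T i '' A = iterZ T (-i) ⁻¹' A := by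
  ext x
  constructor
  · rintro ⟨y, hy, rfl⟩
    rwa [Set.mem_preimage, iterZ_neg_apply_iterZ]
  · intro hx
    refine ⟨_, hx, ?_⟩
    simpa using iterZ_neg_apply_iterZ T (-i) x

theorem preimage_iterZ_of_preimage_eq {A : Set Ω} (hA : T ⁻¹' A = A) (i : ℤ) :
    iterZ T i ⁻¹' A = A := by
  have hA' : T.symm ⁻¹' A = A := by
    conv_lhs => rw [← hA]
    ext x; simp
  obtain ⟨n, rfl | rfl⟩ := i.eq_nat_or_neg
  · rw [iterZ_natCast, Set.preimage_iterate_eq]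
    exact Function.IsFixedPt.iterate hA n
  · rw [iterZ_neg_natCast, Set.preimage_iterate_eq]
    exact Function.IsFixedPt.iterate hA' n

theorem image_iterZ_of_preimage_eq {A : Set Ω} (hA : T ⁻¹' A = A) (i : ℤ) :
    iterZ T i '' A = A := by
  rw [image_iterZ, preimage_iterZ_of_preimage_eq T hA]

variable (P : Measure Ω)

theorem cesaroImage_of_preimage_eq {A : Set Ω} (hA : T ⁻¹' A = A) {n : ℕ} (hn : n ≠ 0) :
    cesaroImage P T A n = P.real A := by
  simp only [cesaroImage, image_iterZ_of_preimage_eq T hA, Finset.sum_const, Finset.card_range,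
    nsmul_eq_mul]
  field_simp

/-- The average of the images of `P` under the first `n` iterates of `T⁻¹`. -/
noncomputable def cesaroMeasure (n : ℕ) : Measure Ω :=
  (n : NNReal)⁻¹ • ∑ i ∈ Finset.range n, P.map (iterZ T (-(i : ℤ)))

instance isFiniteMeasure_cesaroMeasure [IsFiniteMeasure P] (n : ℕ) :
    IsFiniteMeasure (cesaroMeasure T P n) := by
  unfold cesaroMeasure; infer_instance

theorem cesaroMeasure_real [IsFiniteMeasure P] (n : ℕ) {A : Set Ω} (hA : MeasurableSet A) :
    (cesaroMeasure T P n).real A = cesaroImage P T A n := by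
  rw [cesaroMeasure, measureReal_nnreal_smul_apply, cesaroImage, measureReal_def,
    Measure.finsetSum_apply, ENNReal.toReal_sum fun i _ => measure_ne_top _ _]
  simp only [NNReal.coe_inv, NNReal.coe_natCast, one_div]
  congr 1
  refine Finset.sum_congr rfl fun i _ => ?_
  rw [Measure.map_apply (measurable_iterZ T _) hA, image_iterZ, measureReal_def]

/-- The images of `T ⁻¹' A` are those of `A` shifted by one index, so the difference telescopes to
two boundary terms divided by `n`. -/
theorem tendsto_cesaroImage_sub_preimage [IsProbabilityMeasure P] (A : Set Ω) :
    Tendsto (fun n => cesaroImage P T A n - cesaroImage P T (T ⁻¹' A) n) atTop (𝓝 0) := by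
  have hshift : ∀ i : ℤ, iterZ T (i + 1) '' (T ⁻¹' A) = iterZ T i '' A := fun i => by
    rw [image_iterZ, image_iterZ]
    ext x
    have h1 : T (iterZ T (-(i + 1)) x) = iterZ T (-i) x := by
      have := iterZ_add T 1 (-(i + 1)) x
      rw [show (1 : ℤ) + -(i + 1) = -i by ring] at this
      rw [this]
      simp [iterZ]
    rw [Set.mem_preimage, Set.mem_preimage, Set.mem_preimage, h1]
  have hdiff : ∀ n : ℕ, cesaroImage P T A n - cesaroImage P T (T ⁻¹' A) n = 1 / (n : ℝ) *
      (P.real (iterZ T (n : ℤ) '' (T ⁻¹' A)) - P.real (iterZ T ((0 : ℕ) : ℤ) '' (T ⁻¹' A))) :=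
      fun n => by
    rw [cesaroImage, cesaroImage, ← mul_sub, ← Finset.sum_sub_distrib,
      ← Finset.sum_range_sub (fun i : ℕ => P.real (iterZ T (i : ℤ) '' (T ⁻¹' A))) n]
    congr 1
    refine Finset.sum_congr rfl fun i _ => ?_
    rw [← hshift]
    push_cast
    rfl
  refine squeeze_zero_norm (fun n => ?_) (tendsto_one_div_atTop_nhds_zero_nat (𝕜 := ℝ))
  rw [hdiff, norm_mul, Real.norm_of_nonneg (by positivity)]
  refine mul_le_of_le_one_right (by positivity) ?_
  have h1 := measureReal_le_one (μ := P) (s := iterZ T (n : ℤ) '' (T ⁻¹' A))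
  have h2 := measureReal_le_one (μ := P) (s := iterZ T ((0 : ℕ) : ℤ) '' (T ⁻¹' A))
  have h3 := measureReal_nonneg (μ := P) (s := iterZ T (n : ℤ) '' (T ⁻¹' A))
  have h4 := measureReal_nonneg (μ := P) (s := iterZ T ((0 : ℕ) : ℤ) '' (T ⁻¹' A))
  rw [Real.norm_eq_abs, abs_le]
  constructor <;> linarith

theorem exists_invariant_limit [IsProbabilityMeasure P]
    (hlim : ∀ A : Set Ω, MeasurableSet A →
      ∃ l : ℝ, Tendsto (fun n : ℕ => cesaroImage P T A n) atTop (𝓝 l)) :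
    ∃ Q : Measure Ω, IsProbabilityMeasure Q ∧
      (∀ A : Set Ω, MeasurableSet A →
        Tendsto (fun n : ℕ => cesaroImage P T A n) atTop (𝓝 (Q.real A))) ∧
      MeasurePreserving T Q Q := by
  obtain ⟨Q, hQfin, hQ⟩ := exists_measure_of_tendsto_measureReal (cesaroMeasure T P)
    fun A hA => by simpa only [cesaroMeasure_real T P _ hA] using hlim A hA
  have hQ' : ∀ A : Set Ω, MeasurableSet A →
      Tendsto (fun n : ℕ => cesaroImage P T A n) atTop (𝓝 (Q.real A)) := fun A hA => by
    simpa only [cesaroMeasure_real T P _ hA] using hQ A hA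
  refine ⟨Q, ?_, hQ', T.measurable, ?_⟩
  · have h1 : Tendsto (fun n => cesaroImage P T Set.univ n) atTop (𝓝 1) :=
      tendsto_const_nhds.congr' <| by
        filter_upwards [eventually_ne_atTop 0] with n hn
        rw [cesaroImage_of_preimage_eq T P Set.preimage_univ hn, probReal_univ]
    have h2 := tendsto_nhds_unique (hQ' _ MeasurableSet.univ) h1
    rw [measureReal_def, ENNReal.toReal_eq_one_iff] at h2
    exact ⟨h2⟩
  · ext A hA
    rw [Measure.map_apply T.measurable hA, ← measureReal_eq_measureReal_iff]
    have h := tendsto_nhds_unique (tendsto_cesaroImage_sub_preimage T P A)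
      ((hQ' A hA).sub (hQ' _ (T.measurable hA)))
    linarith

variable {T P} {Q : Measure Ω}

theorem measureReal_eq_of_preimage_eq
    (hQ : ∀ A : Set Ω, MeasurableSet A →
      Tendsto (fun n : ℕ => cesaroImage P T A n) atTop (𝓝 (Q.real A)))
    {A : Set Ω} (hA : MeasurableSet A) (hTA : T ⁻¹' A = A) : P.real A = Q.real A :=
  tendsto_nhds_unique (tendsto_const_nhds.congr' <| by
    filter_upwards [eventually_ne_atTop 0] with n hn
    rw [cesaroImage_of_preimage_eq T P hTA hn]) (hQ A hA)

/-- The union of all integer translates of a `Q`-null set is invariant and still `Q`-null, and `P`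
agrees with `Q` on invariant sets. -/
theorem absolutelyContinuous_of_tendsto_cesaroImage [IsFiniteMeasure P] [IsFiniteMeasure Q]
    (hQ : ∀ A : Set Ω, MeasurableSet A →
      Tendsto (fun n : ℕ => cesaroImage P T A n) atTop (𝓝 (Q.real A)))
    (hT : MeasurePreserving T Q Q) : P ≪ Q := by
  refine Measure.AbsolutelyContinuous.mk fun N hN hN0 => ?_
  let U : Set Ω := ⋃ i : ℤ, iterZ T i ⁻¹' N
  have hU : MeasurableSet U := MeasurableSet.iUnion fun i => measurable_iterZ T i hN
  have hTU : T ⁻¹' U = U := by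
    ext x
    have hx : T x = iterZ T 1 x := by simp [iterZ]
    simp only [U, Set.mem_preimage, Set.mem_iUnion, hx, ← iterZ_add]
    exact ⟨fun ⟨i, hi⟩ => ⟨i + 1, hi⟩, fun ⟨i, hi⟩ => ⟨i - 1, by simpa using hi⟩⟩
  have hQU : Q U = 0 := measure_iUnion_null fun i => by
    rw [(measurePreserving_iterZ hT i).measure_preimage hN.nullMeasurableSet, hN0]
  have hPU : P U = 0 := by
    have h := measureReal_eq_of_preimage_eq hQ hU hTU
    rwa [measureReal_def Q, hQU, ENNReal.toReal_zero, measureReal_eq_zero_iff] at h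
  refine measure_mono_null (fun x hx => Set.mem_iUnion.2 ⟨0, ?_⟩) hPU
  simpa [iterZ] using hx

end Iterates

/-! ### Two-sided averages -/

section TwoSided

theorem sum_Icc_neg_natCast (a : ℤ → ℝ) (m n : ℕ) :
    ∑ i ∈ Finset.Icc (-(m : ℤ)) (n : ℤ), a i =
      ∑ i ∈ Finset.range (n + 1), a i + ∑ i ∈ Finset.range (m + 1), a (-(i : ℤ)) - a 0 := by
  induction m with
  | zero =>
    induction n with
    | zero => simp
    | succ n ih =>
      have h : Finset.Icc (-((0 : ℕ) : ℤ)) ((n + 1 : ℕ) : ℤ) =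
          insert ((n + 1 : ℕ) : ℤ) (Finset.Icc (-((0 : ℕ) : ℤ)) (n : ℤ)) := by
        ext; simp only [Finset.mem_Icc, Finset.mem_insert]; omega
      rw [h, Finset.sum_insert (by simp), ih, Finset.sum_range_succ _ (n + 1)]
      ring
  | succ m ih =>
    have h : Finset.Icc (-((m + 1 : ℕ) : ℤ)) (n : ℤ) =
        insert (-((m + 1 : ℕ) : ℤ)) (Finset.Icc (-(m : ℤ)) (n : ℤ)) := by
      ext; simp only [Finset.mem_Icc, Finset.mem_insert]; omega
    rw [h, Finset.sum_insert (by simp), ih, Finset.sum_range_succ _ (m + 1)]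
    ring

theorem twoSidedAverage_const (c : ℝ) (m n : ℕ) : twoSidedAverage (fun _ => c) m n = c := by
  have h : (m : ℝ) + n + 1 ≠ 0 := by positivity
  rw [twoSidedAverage, sum_Icc_neg_natCast]
  simp only [Finset.sum_const, Finset.card_range, nsmul_eq_mul, Nat.cast_add, Nat.cast_one]
  field_simp
  ring

theorem twoSidedAverage_neg (a : ℤ → ℝ) (m n : ℕ) :
    twoSidedAverage (fun i => a (-i)) m n = twoSidedAverage a n m := by
  rw [twoSidedAverage, twoSidedAverage, sum_Icc_neg_natCast, sum_Icc_neg_natCast]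
  simp only [neg_neg, neg_zero]
  rw [add_comm (m : ℝ), add_comm (∑ i ∈ Finset.range (n + 1), a (-(i : ℤ)))]

theorem abs_twoSidedAverage_le {a : ℤ → ℝ} {c : ℝ} (ha : ∀ i, |a i| ≤ c) (m n : ℕ) :
    |twoSidedAverage a m n| ≤ c := by
  rw [← twoSidedAverage_const c m n, twoSidedAverage, twoSidedAverage, abs_mul,
    abs_of_nonneg (by positivity)]
  gcongr
  exact (Finset.abs_sum_le_sum_abs _ _).trans (Finset.sum_le_sum fun i _ => ha i)

theorem TendstoTwoSided.neg_index {a : ℤ → ℝ} {l : ℝ} (h : TendstoTwoSided a l) :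
    TendstoTwoSided (fun i => a (-i)) l := by
  have hswap : Tendsto Prod.swap (comap (fun p : ℕ × ℕ => p.1 + p.2) atTop)
      (comap (fun p : ℕ × ℕ => p.1 + p.2) atTop) := by
    refine tendsto_comap_iff.2 ?_
    have h0 : (fun p : ℕ × ℕ => p.1 + p.2) ∘ Prod.swap = fun p => p.1 + p.2 :=
      funext fun p => add_comm p.2 p.1
    rw [h0]
    exact tendsto_comap
  exact (Tendsto.comp h hswap).congr fun p => (twoSidedAverage_neg a p.1 p.2).symm

theorem TendstoTwoSided.const_eq {c l : ℝ} (h : TendstoTwoSided (fun _ => c) l) : c = l := by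
  have : (comap (fun p : ℕ × ℕ => p.1 + p.2) atTop).NeBot :=
    atTop_neBot.comap_of_surj fun n => ⟨(n, 0), by simp⟩
  simp only [TendstoTwoSided, twoSidedAverage_const] at h
  exact tendsto_nhds_unique tendsto_const_nhds h

/-- Linear error bounds valid for every `n` simply add, so the constants are absorbed by `m + n + 1`
even when only one of `m`, `n` grows. -/
theorem tendstoTwoSided_of_abs_sum_sub_le {a : ℤ → ℝ} {l : ℝ}
    (hpos : ∀ k : ℕ, ∃ C, ∀ n : ℕ,
      |∑ i ∈ Finset.range n, a i - n * l| ≤ C + n * (1 / ((k : ℝ) + 1)))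
    (hneg : ∀ k : ℕ, ∃ C, ∀ n : ℕ,
      |∑ i ∈ Finset.range n, a (-(i : ℤ)) - n * l| ≤ C + n * (1 / ((k : ℝ) + 1))) :
    TendstoTwoSided a l := by
  refine Metric.tendsto_nhds.2 fun ε hε => ?_
  obtain ⟨k, hk⟩ := exists_nat_one_div_lt (show (0 : ℝ) < ε / 2 by positivity)
  obtain ⟨C, hC⟩ := hpos k
  obtain ⟨D, hD⟩ := hneg k
  -- Index `0` belongs to both half-sums, whence the term `|a 0 - l|`; the extra `ε / 2` arises
  -- because their lengths add up to one more than `m + n + 1`.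
  obtain ⟨N, hN⟩ := exists_nat_gt ((C + D + |a 0 - l| + ε / 2) / (ε / 2))
  refine mem_comap.2 ⟨Set.Ici N, Ici_mem_atTop N, fun p hp => ?_⟩
  obtain ⟨m, n⟩ := p
  have hp' : (N : ℝ) ≤ m + n := by exact_mod_cast hp
  have hc := hC (n + 1)
  have hd := hD (m + 1)
  rw [div_lt_iff₀ (by positivity)] at hN
  have hm : (0 : ℝ) < (m : ℝ) + n + 1 := by positivity
  have key : twoSidedAverage a m n - l = (1 / ((m : ℝ) + n + 1)) *
      ((∑ i ∈ Finset.range (n + 1), a i - (n + 1 : ℕ) * l) +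
        (∑ i ∈ Finset.range (m + 1), a (-(i : ℤ)) - (m + 1 : ℕ) * l) - (a 0 - l)) := by
    rw [twoSidedAverage, sum_Icc_neg_natCast]
    push_cast
    field_simp
    ring
  change dist (twoSidedAverage a m n) l < ε
  rw [Real.dist_eq, key, abs_mul, abs_of_pos (by positivity), one_div, inv_mul_lt_iff₀ hm]
  push_cast at hc hd ⊢
  have h1 : ((n : ℝ) + 1) * (1 / ((k : ℝ) + 1)) ≤ (n + 1) * (ε / 2) := by gcongr
  have h2 : ((m : ℝ) + 1) * (1 / ((k : ℝ) + 1)) ≤ (m + 1) * (ε / 2) := by gcongr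
  have h3 : (N : ℝ) * (ε / 2) ≤ (m + n) * (ε / 2) := by gcongr
  have h4 := le_abs_self (a 0 - l)
  have h5 := neg_abs_le (a 0 - l)
  rw [abs_le] at hc hd
  rw [abs_lt]
  constructor <;> linarith

end TwoSided

/-! ### Ergodicity, averaged mixing and pointwise convergence -/

section Equivalences

variable {Ω : Type*} [MeasurableSpace Ω] {P Q : Measure Ω} {T : Ω ≃ᵐ Ω}

/-- Two-sided **pointwise ergodic theorem** for an ergodic invertible transformation. -/
theorem Ergodic.ae_tendstoTwoSided [IsProbabilityMeasure Q] (hT : Ergodic T Q) {f : Ω → ℝ}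
    (hfm : Measurable f) (hf : Integrable f Q) :
    ∀ᵐ x ∂Q, TendstoTwoSided (fun i : ℤ => f (iterZ T i x)) (∫ y, f y ∂Q) := by
  filter_upwards [hT.ae_abs_birkhoffSum_sub_le hfm hf, hT.symm.ae_abs_birkhoffSum_sub_le hfm hf]
    with x h1 h2
  refine tendstoTwoSided_of_abs_sum_sub_le ?_ ?_
  · simpa only [iterZ_natCast, birkhoffSum] using h1
  · simpa only [iterZ_neg_natCast, birkhoffSum] using h2

/-- If the two-sided averages of the indicator of `C` converge almost everywhere to a constant,
then the averages of `P (B ∩ T ^ i C)` converge. -/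
theorem tendstoTwoSided_measureReal_inter [IsProbabilityMeasure P] {B C : Set Ω}
    (hC : MeasurableSet C) {l : ℝ}
    (h : ∀ᵐ x ∂P, TendstoTwoSided (fun i : ℤ => C.indicator (fun _ => (1 : ℝ)) (iterZ T i x)) l) :
    TendstoTwoSided (fun i : ℤ => P.real (B ∩ iterZ T i '' C)) (P.real B * l) := by
  have hm : ∀ i : ℤ, Measurable fun x => C.indicator (fun _ => (1 : ℝ)) (iterZ T i x) := fun i =>
    (measurable_const.indicator hC).comp (measurable_iterZ T i)
  have hle : ∀ (i : ℤ) (x : Ω), |C.indicator (fun _ => (1 : ℝ)) (iterZ T i x)| ≤ 1 := fun i x => by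
    by_cases hx : iterZ T i x ∈ C <;> simp [hx]
  have hint : ∀ i : ℤ, ∫ x in B, C.indicator (fun _ => (1 : ℝ)) (iterZ T i x) ∂P =
      P.real (B ∩ iterZ T (-i) '' C) := fun i => by
    have hpre : (fun x => C.indicator (fun _ => (1 : ℝ)) (iterZ T i x)) =
        (iterZ T i ⁻¹' C).indicator 1 := rfl
    rw [hpre, integral_indicator_one (measurable_iterZ T i hC),
      measureReal_restrict_apply (measurable_iterZ T i hC), image_iterZ, neg_neg, Set.inter_comm]
  have havg : ∀ p : ℕ × ℕ, ∫ x in B, twoSidedAverage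
      (fun i => C.indicator (fun _ => (1 : ℝ)) (iterZ T i x)) p.1 p.2 ∂P =
      twoSidedAverage (fun i => P.real (B ∩ iterZ T (-i) '' C)) p.1 p.2 := fun p => by
    simp only [twoSidedAverage]
    rw [integral_const_mul, integral_finsetSum]
    · simp only [hint]
    · exact fun i _ => Integrable.of_bound (hm i).aestronglyMeasurable 1
        (Eventually.of_forall (hle i))
  have hlim : Tendsto (fun p : ℕ × ℕ => ∫ x in B, twoSidedAverage
      (fun i => C.indicator (fun _ => (1 : ℝ)) (iterZ T i x)) p.1 p.2 ∂P)
      (comap (fun p : ℕ × ℕ => p.1 + p.2) atTop) (𝓝 (∫ _ in B, l ∂P)) := by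
    refine tendsto_integral_filter_of_dominated_convergence (fun _ => (1 : ℝ))
      (Eventually.of_forall fun p => ?_)
      (Eventually.of_forall fun p => Eventually.of_forall fun x =>
        abs_twoSidedAverage_le (fun i => hle i x) p.1 p.2)
      (integrable_const 1) (ae_restrict_of_ae h)
    exact ((Finset.measurable_fun_sum _ fun i _ => hm i).const_mul _).aestronglyMeasurable
  have hres : TendstoTwoSided (fun i => P.real (B ∩ iterZ T (-i) '' C)) (P.real B * l) := by
    simpa [TendstoTwoSided, havg] using hlim
  -- Integrating along `T ^ i` produced the images under `T ^ (-i)`; reflecting the index only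
  -- exchanges `m` and `n`.
  simpa using hres.neg_index

/-- For invariant `A` the averaged sequence is constant, so its limit forces `P(A) = P(A) Q(A)`;
since `P(A) = Q(A)`, this makes `Q(A)` idempotent. -/
theorem ergodic_of_tendstoTwoSided_measureReal_inter [IsProbabilityMeasure Q]
    (hT : MeasurePreserving T Q Q)
    (hinv : ∀ A : Set Ω, MeasurableSet A → T ⁻¹' A = A → P.real A = Q.real A)
    (h : ∀ A : Set Ω, MeasurableSet A →
      TendstoTwoSided (fun i : ℤ => P.real (A ∩ iterZ T i '' A)) (P.real A * Q.real A)) :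
    Ergodic T Q := by
  refine ⟨hT, ⟨fun {A} hA hTA => ?_⟩⟩
  have hsq := h A hA
  simp only [image_iterZ_of_preimage_eq T hTA, Set.inter_self] at hsq
  have heq := hsq.const_eq
  rw [hinv A hA hTA] at heq
  rw [eventuallyConst_set']
  rcases mul_eq_zero.1 (show Q.real A * (Q.real A - 1) = 0 by linarith) with h0 | h1
  · left
    rwa [measureReal_eq_zero_iff, ← ae_eq_empty] at h0
  · right
    rw [sub_eq_zero, measureReal_def, ENNReal.toReal_eq_one_iff] at h1
    rw [ae_eq_univ]
    exact (prob_compl_eq_zero_iff hA).2 h1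

end Equivalences

theorem theorem4p6 {Ω : Type*} [MeasurableSpace Ω] (P : Measure Ω) [IsProbabilityMeasure P]
    (T : Ω ≃ᵐ Ω)
    (hlim : ∀ A : Set Ω, MeasurableSet A →
      ∃ l : ℝ, Tendsto (fun n : ℕ => cesaroImage P T A n) atTop (𝓝 l)) :
    ∃ Q : Measure Ω,
      IsProbabilityMeasure Q ∧
      (∀ A : Set Ω, MeasurableSet A →
        Tendsto (fun n : ℕ => cesaroImage P T A n) atTop (𝓝 (Q.real A))) ∧
      MeasurePreserving T Q Q ∧
      List.TFAE [
        Ergodic T Q,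
        ∀ B C : Set Ω, MeasurableSet B → MeasurableSet C →
          TendstoTwoSided (fun i : ℤ => P.real (B ∩ iterZ T i '' C)) (P.real B * Q.real C),
        ∀ f : Ω → ℝ, Measurable f → Integrable f Q →
          ∀ᵐ ω ∂P, TendstoTwoSided (fun i : ℤ => f (iterZ T i ω)) (∫ x, f x ∂Q)] := by
  obtain ⟨Q, hprob, hQ, hT⟩ := exists_invariant_limit T P hlim
  refine ⟨Q, hprob, hQ, hT, ?_⟩
  tfae_have 1 → 3 := fun h f hfm hf =>
    (absolutelyContinuous_of_tendsto_cesaroImage hQ hT).ae_le (h.ae_tendstoTwoSided hfm hf)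
  tfae_have 3 → 2 := fun h B C _ hC => by
    refine tendstoTwoSided_measureReal_inter hC ?_
    have hC1 := h (C.indicator 1) (measurable_one.indicator hC)
      ((integrable_const 1).indicator hC)
    rwa [integral_indicator_one hC] at hC1
  tfae_have 2 → 1 := fun h =>
    ergodic_of_tendstoTwoSided_measureReal_inter hT
      (fun A hA hTA => measureReal_eq_of_preimage_eq hQ hA hTA) fun A hA => h A A hA hA
  tfae_finish
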